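/- Let $S$ and $A$ be the finite state and action sets of a Markov decision process with transition model $P(x'\mid x,a)$ and some initial state distribution. For a stationary (possibly randomized) policy $\pi$ let $P(\pi)_{x,x'}=\sum_{a}\pi(a\mid x)P(x'\mid x,a)$. Assume the mixing condition with a constant $\tau\ge \tfrac12$: for every policy $\pi$ and all distributions $d,d'$ on $S$, $\|dP(\pi)-d'P(\pi)\|_1\le e^{-1/\tau}\|d-d'\|_1$. Let $d_\pi$ be the stationary distribution of $\pi$ on state-action pairs, i.e. the limit of the law of (state, action) at time $t$ under $\pi$ as $t\to\infty$, and for $l\in\mathbb{R}^{S\times A}$ put $\langle l,d\rangle=\sum_{x,a}l(x,a)d(x,a)$ and $$Q_{\pi,l}(s,a)=\mathbb{E}\Big[\sum_{t=1}^{\infty}\big(l(s_t,a_t)-\langle l,d_\pi\rangle\big)\,\Big|\,s_1=s,\ a_1=a,\ \pi\Big].$$ Let $\Delta_L$ be the set of convex combinations of given loss vectors $l_1,\dots,l_L\in[0,1]^{S\times A}$. An adversary chooses in each round $t$ a loss in $\Delta_L$ as a function of the agent's previous policies $\pi_1,\dots,\pi_{t-1}$; write $l_t^{\pi_t}$ for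 its choice in round $t$ when the agent plays $\pi_1,\pi_2,\dots$, and $l_t^{\pi}$ for its choice in round $t$ when the agent plays the fixed policy $\pi$ in all rounds. Fix a horizon $T$ and assume that the adversary's external regret with respect to stationary distributions satisfies, for every sequence of policies $\pi_1,\pi_2,\dots$, $$\max_{l\in\Delta_L}\Big(\sum_{t=1}^T\langle l,d_{\pi_t}\rangle-\sum_{t=1}^T\langle l_t^{\pi_t},d_{\pi_t}\rangle\Big)\le\sqrt{\frac{T\log L}{2}} .$$ Suppose the agent follows MDP-Expert (MDP-E): it runs in each state $s$ the Multiplicative Weights Update over the actions with feedback $Q_{\pi_t,l_t}(s,\cdot)$, where $l_t=l_t^{\pi_t}$, that is, $\pi_1(\cdot\mid s)$ is uniform on $A$ and $$\pi_{t+1}(a\mid s)=\frac{\pi_t(a\mid s)\,e^{-\mu Q_{\pi_t,l_t}(s,a)}}{\sum_{b\in A}\pi_t(b\mid s)\,e^{-\mu Q_{\pi_t,l_t}(s,b)}},\qquad \mu=\frac{1}{3\tau}\sqrt{\frac{8\log|A|}{T}} .$$ Then for every stationary policy $\pi$, $$\sum_{t=1}^T\big\langle l_t^{\pi_t},d_{\pi_t}\big\rangle-\sum_{t=1}^T\big\langle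 l_t^{\pi},d_{\pi}\big\rangle\le\sqrt{\frac{T\log L}{2}}+3\tau\sqrt{\frac{T\log|A|}{2}} .$$ -/

import Mathlib

open Filter

noncomputable section

namespace OMDP

/-- A finite Markov decision process without losses: a transition model `P(x' | x, a)` and an
initial state distribution. -/
structure MDP (S A : Type*) [Fintype S] where
  /-- `trans x a x'` is `P(x' | x, a)`. -/
  trans : S → A → S → ℝ
  /-- the distribution of the initial state -/
  init : S → ℝ
  trans_mem : ∀ x a, trans x a ∈ stdSimplex ℝ S
  init_mem : init ∈ stdSimplex ℝ S

/-- A stationary (possibly randomized) policy; `prob x a` is `π(a | x)`. -/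
structure Policy (S A : Type*) [Fintype A] where
  prob : S → A → ℝ
  prob_mem : ∀ x, prob x ∈ stdSimplex ℝ A

variable {S A : Type*} [Fintype S] [Fintype A]

/-- The pairing `⟨l, d⟩` of vectors indexed by state-action pairs. -/
def pairing (l d : S → A → ℝ) : ℝ := ∑ x, ∑ a, l x a * d x a

/-- The `ℓ¹` norm of a vector indexed by states. -/
def l1Norm (d : S → ℝ) : ℝ := ∑ x, |d x|

/-- The state transition matrix `P(π)` induced by a policy. -/
def MDP.transMatrix (M : MDP S A) (π : Policy S A) : Matrix S S ℝ :=
  Matrix.of fun x x' => ∑ a, π.prob x a * M.trans x a x'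

/-- The mixing time assumption with constant `τ`. -/
def MDP.Mixing (M : MDP S A) (τ : ℝ) : Prop :=
  ∀ d ∈ stdSimplex ℝ S, ∀ d' ∈ stdSimplex ℝ S, ∀ π : Policy S A,
    l1Norm (Matrix.vecMul d (M.transMatrix π) - Matrix.vecMul d' (M.transMatrix π))
      ≤ Real.exp (-1 / τ) * l1Norm (d - d')

/-- The law of the state-action pair after `n` steps, when the first pair has law `v` and all
later actions are drawn from `π`. -/
def MDP.law (M : MDP S A) (π : Policy S A) (v : S → A → ℝ) : ℕ → S → A → ℝ
  | 0 => v
  | n + 1 => fun x' a' => (∑ x, ∑ a, M.law π v n x a * M.trans x a x') * π.prob x' a'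

/-- The law of the state-action pair at round `n + 1` when `π` is followed throughout, starting
from the initial state distribution. -/
def MDP.occupancy (M : MDP S A) (π : Policy S A) : ℕ → S → A → ℝ :=
  M.law π fun x a => M.init x * π.prob x a

/-- The stationary state-action distribution `d_π`: the limit of the law of the state-action
pair at round `n`. Under the mixing assumption this limit exists and does not depend on the
initial distribution. -/
def MDP.stationary (M : MDP S A) (π : Policy S A) (x : S) (a : A) : ℝ :=
  limUnder atTop fun n => M.occupancy π n x a

/-- The average loss `η_l(π) = ⟨l, d_π⟩`. -/
def MDP.avgLoss (M : MDP S A) (π : Policy S A) (l : S → A → ℝ) : ℝ :=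
  pairing l (M.stationary π)

open Classical in
/-- The accumulated loss `Q_{π,l}(s,a) = E[∑_{t ≥ 1} (l(s_t,a_t) - η_l(π)) | s_1 = s, a_1 = a, π]`.
Under the mixing assumption the series of expectations converges absolutely. -/
def MDP.Q (M : MDP S A) (π : Policy S A) (l : S → A → ℝ) (s : S) (a : A) : ℝ :=
  ∑' n : ℕ, (pairing l (M.law π (fun x b => if x = s ∧ b = a then 1 else 0) n) - M.avgLoss π l)

/-- `Δ_L`: all convex combinations of the loss vectors `ℓ 0, …, ℓ (L - 1)`. -/
def lossSimplex {L : ℕ} (ℓ : Fin L → S → A → ℝ) : Set (S → A → ℝ) :=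
  {l | ∃ w ∈ stdSimplex ℝ (Fin L), l = fun x a => ∑ i, w i * ℓ i x a}

/-- An adaptive adversary: at each round it chooses an element of `Δ_L` as a function of all the
policies that the agent has used in the earlier rounds. -/
structure Adversary {L : ℕ} (ℓ : Fin L → S → A → ℝ) where
  respond : (t : ℕ) → (Fin t → Policy S A) → S → A → ℝ
  respond_mem : ∀ t h, respond t h ∈ lossSimplex ℓ

/-- The loss that the adversary plays in round `t + 1` when the agent plays the policies
`π 0, π 1, …` in rounds `1, 2, …`. -/
def Adversary.loss {L : ℕ} {ℓ : Fin L → S → A → ℝ} (adv : Adversary ℓ) (π : ℕ → Policy S A)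
    (t : ℕ) : S → A → ℝ :=
  adv.respond t fun i => π i

/-- Over `T` rounds the adversary's external regret, measured through the stationary
distributions of the agent's policies, is at most `√(T log L / 2)` for every sequence of
policies of the agent. -/
def Adversary.NoExternalRegret {L : ℕ} {ℓ : Fin L → S → A → ℝ} (adv : Adversary ℓ)
    (M : MDP S A) (T : ℕ) : Prop :=
  ∀ π : ℕ → Policy S A, ∀ l ∈ lossSimplex ℓ,
    ∑ t ∈ Finset.range T, pairing l (M.stationary (π t))
      - ∑ t ∈ Finset.range T, pairing (adv.loss π t) (M.stationary (π t))
      ≤ Real.sqrt (T * Real.log L / 2)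

/-- One step of Multiplicative Weights Update with learning rate `μ` and feedback `k`. -/
def mwuStep (μ : ℝ) (p k : A → ℝ) (a : A) : ℝ :=
  p a * Real.exp (-μ * k a) / ∑ b, p b * Real.exp (-μ * k b)

/-- The agent's policies `π 0, π 1, …` (rounds `1, 2, …`) are those of MDP-Expert against the
adversary: in each state `s`, Multiplicative Weights Update over the actions, with constant
learning rate `μ`, starts from the uniform distribution and receives in each round `t` the
feedback `Q_{π_t, l_t}(s, ·)`. -/
def FollowsMDPE {L : ℕ} {ℓ : Fin L → S → A → ℝ} (M : MDP S A) (adv : Adversary ℓ) (μ : ℝ)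
    (π : ℕ → Policy S A) : Prop :=
  (∀ s a, (π 0).prob s a = 1 / Fintype.card A) ∧
    ∀ t s, (π (t + 1)).prob s = mwuStep μ ((π t).prob s) (M.Q (π t) (adv.loss π t) s)

/-- The learning rate of Multiplicative Weights Update tuned to `n` experts, horizon `T` and
feedback of range `R`. -/
def mwuRate (n T : ℕ) (R : ℝ) : ℝ := Real.sqrt (8 * Real.log n / T) / R

end OMDP

end

/-! Insert `∑ ⟨l_t, d_π⟩`, with the losses actually played against the agent, between the two sums.

The agent's part, `∑ ⟨l_t, d_{π_t}⟩ - ∑ ⟨l_t, d_π⟩`, splits over states by the performance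
difference identity (`Mixing.avgLoss_sub_avgLoss`): each summand is the average, over the stationary
state law of `π`, of the gap between `π_t` and `π` in the feedback `Q`. So it is at most the average
of the local regrets, which `mwu_regret` bounds. Only differences of feedback between actions enter
Hoeffding's lemma, so it suffices that `Q(s, ·)` has range `3τ` (`Mixing.Q_sub_Q_le`), whatever its
sign.

The adversary's part, `∑ ⟨l_t, d_π⟩ - ∑ ⟨l_t^π, d_π⟩`, is its external regret against the constant
sequence `π`: by convexity the average of the `l_t` is a single competitor in `Δ_L`. -/

/-! ### Multiplicative Weights Update. -/

open MeasureTheory ProbabilityTheory in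
/-- Hoeffding's lemma for a probability vector on a finite type. -/
theorem OMDP.sum_mul_exp_le_hoeffding {A : Type*} [Fintype A] {p k : A → ℝ} {R : ℝ}
    (hp : p ∈ stdSimplex ℝ A) (hk : ∀ a b, k a - k b ≤ R) (t : ℝ) :
    ∑ a, p a * Real.exp (t * k a) ≤ Real.exp (t * ∑ a, p a * k a + t ^ 2 * R ^ 2 / 8) := by
  classical
  have hA : Nonempty A := by
    by_contra h
    rw [not_nonempty_iff] at h
    simpa using hp.2
  obtain ⟨b₀, hb₀⟩ := Finite.exists_min k
  let _ : MeasurableSpace A := ⊤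
  let P : PMF A := PMF.ofFintype (fun a => ENNReal.ofReal (p a)) (by
    rw [← ENNReal.ofReal_sum_of_nonneg fun a _ => hp.1 a, hp.2, ENNReal.ofReal_one])
  have hP : ∀ f : A → ℝ, ∫ a, f a ∂P.toMeasure = ∑ a, p a * f a := fun f => by
    rw [PMF.integral_eq_sum]
    simp [P, hp.1]
  have hR : 0 ≤ R := by simpa using hk b₀ b₀
  -- This bounds the moment generating function of the centred `k`, with variance proxy `(R / 2) ^
  -- 2`; the final computation restores the mean.
  have h := (hasSubgaussianMGF_of_mem_Icc (μ := P.toMeasure) (X := k)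
    (a := k b₀) (b := k b₀ + R) measurable_from_top.aemeasurable
    (ae_of_all _ fun a => ⟨hb₀ a, by linarith [hk a b₀]⟩)).mgf_le t
  rw [mgf, hP, hP] at h
  have hc : (((‖k b₀ + R - k b₀‖₊ / 2) ^ 2 : NNReal) : ℝ) = R ^ 2 / 4 := by
    simp [abs_of_nonneg hR]; ring
  rw [hc] at h
  calc ∑ a, p a * Real.exp (t * k a)
      = Real.exp (t * ∑ a, p a * k a) *
          ∑ a, p a * Real.exp (t * (k a - ∑ a, p a * k a)) := by
        rw [Finset.mul_sum]
        refine Finset.sum_congr rfl fun a _ => ?_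
        rw [mul_left_comm, ← Real.exp_add]
        ring_nf
    _ ≤ _ := by
        rw [Real.exp_add]
        refine mul_le_mul_of_nonneg_left (h.trans_eq ?_) (Real.exp_pos _).le
        ring_nf

/-- Regret of Multiplicative Weights Update against a fixed action, for an arbitrary learning
rate. -/
theorem OMDP.mwu_regret_action {A : Type*} [Fintype A] {p k : ℕ → A → ℝ} {R μ : ℝ}
    (hp : ∀ t, p t ∈ stdSimplex ℝ A) (h0 : ∀ a, p 0 a = 1 / Fintype.card A)
    (hs : ∀ t, p (t + 1) = OMDP.mwuStep μ (p t) (k t)) (hk : ∀ t a b, k t a - k t b ≤ R)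
    (T : ℕ) (a : A) :
    μ * ∑ t ∈ Finset.range T, (∑ b, p t b * k t b - k t a)
      ≤ Real.log (Fintype.card A) + T * (μ ^ 2 * R ^ 2 / 8) := by
  have hn : (0 : ℝ) < Fintype.card A := by
    have : Nonempty A := ⟨a⟩
    exact_mod_cast Fintype.card_pos
  -- The weight of `a` itself serves as potential: Hoeffding bounds each normalizer from above, so
  -- large regret against `a` forces a large weight, which cannot exceed 1.
  have key : ∀ T : ℕ, Real.exp (∑ t ∈ Finset.range T,
      (μ * (∑ b, p t b * k t b - k t a) - μ ^ 2 * R ^ 2 / 8)) / Fintype.card A ≤ p T a := by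
    intro T
    induction T with
    | zero => simp [h0]
    | succ T ih =>
      have hpos : 0 < p T a := lt_of_lt_of_le (by positivity) ih
      have hZ := OMDP.sum_mul_exp_le_hoeffding (hp T) (hk T) (-μ)
      have hZ0 : 0 < ∑ b, p T b * Real.exp (-μ * k T b) :=
        Finset.sum_pos' (fun b _ => mul_nonneg ((hp T).1 b) (Real.exp_pos _).le)
          ⟨a, Finset.mem_univ a, by positivity⟩
      rw [hs, OMDP.mwuStep, le_div_iff₀ hZ0, Finset.sum_range_succ, Real.exp_add]
      have hE : Real.exp (μ * (∑ b, p T b * k T b - k T a) - μ ^ 2 * R ^ 2 / 8) *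
          Real.exp (-μ * ∑ b, p T b * k T b + (-μ) ^ 2 * R ^ 2 / 8) = Real.exp (-μ * k T a) := by
        rw [← Real.exp_add]; ring_nf
      calc _ ≤ Real.exp (∑ t ∈ Finset.range T,
              (μ * (∑ b, p t b * k t b - k t a) - μ ^ 2 * R ^ 2 / 8)) *
              Real.exp (μ * (∑ b, p T b * k T b - k T a) - μ ^ 2 * R ^ 2 / 8) / Fintype.card A *
              Real.exp (-μ * ∑ b, p T b * k T b + (-μ) ^ 2 * R ^ 2 / 8) :=
            mul_le_mul_of_nonneg_left hZ (by positivity)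
        _ = Real.exp (∑ t ∈ Finset.range T,
              (μ * (∑ b, p t b * k t b - k t a) - μ ^ 2 * R ^ 2 / 8)) / Fintype.card A *
              Real.exp (-μ * k T a) := by rw [← hE]; ring
        _ ≤ _ := mul_le_mul_of_nonneg_right ih (Real.exp_pos _).le
  have h1 : p T a ≤ 1 := by
    rw [← (hp T).2]
    exact Finset.single_le_sum (fun b _ => (hp T).1 b) (Finset.mem_univ a)
  have h2 := (key T).trans h1
  rw [div_le_one hn, ← Real.le_log_iff_exp_le hn, Finset.sum_sub_distrib, ← Finset.mul_sum] at h2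
  simp only [Finset.sum_const, Finset.card_range, nsmul_eq_mul] at h2
  linarith

/-- Regret of Multiplicative Weights Update with the tuned learning rate, against a fixed
mixed action. -/
theorem OMDP.mwu_regret {A : Type*} [Fintype A] {p k : ℕ → A → ℝ} {R : ℝ} {T : ℕ} (hR : 0 < R)
    (hp : ∀ t, p t ∈ stdSimplex ℝ A) (h0 : ∀ a, p 0 a = 1 / Fintype.card A)
    (hs : ∀ t, p (t + 1) =
      OMDP.mwuStep (OMDP.mwuRate (Fintype.card A) T R) (p t) (k t))
    (hk : ∀ t a b, k t a - k t b ≤ R) {q : A → ℝ} (hq : q ∈ stdSimplex ℝ A) :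
    ∑ t ∈ Finset.range T, (∑ a, p t a * k t a - ∑ a, q a * k t a)
      ≤ R * Real.sqrt (T * Real.log (Fintype.card A) / 2) := by
  obtain ⟨a₀⟩ : Nonempty A := by
    by_contra h
    rw [not_nonempty_iff] at h
    simpa using hq.2
  have hmix : ∑ t ∈ Finset.range T, (∑ a, p t a * k t a - ∑ a, q a * k t a)
      = ∑ a, q a * ∑ t ∈ Finset.range T, (∑ b, p t b * k t b - k t a) := by
    simp_rw [Finset.mul_sum]
    rw [Finset.sum_comm]
    refine Finset.sum_congr rfl fun t _ => ?_
    simp_rw [mul_sub]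
    rw [Finset.sum_sub_distrib, ← Finset.sum_mul, hq.2, one_mul]
  have hact : ∀ a, ∑ t ∈ Finset.range T, (∑ b, p t b * k t b - k t a)
      ≤ R * Real.sqrt (T * Real.log (Fintype.card A) / 2) := by
    intro a
    rcases Nat.eq_zero_or_pos T with rfl | hT
    · simp
    have hT' : (0 : ℝ) < T := by exact_mod_cast hT
    -- With a single action the learning rate is 0 and cannot be divided out, but the regret is
    -- identically 0.
    rcases subsingleton_or_nontrivial A with hA | hA
    · have h1 : ∀ t, ∑ b, p t b * k t b - k t a = 0 := fun t => by
        have hb : ∀ b, p t b * k t b = p t b * k t a := fun b => by rw [Subsingleton.elim b a]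
        simp_rw [hb]
        rw [← Finset.sum_mul, (hp t).2, one_mul, sub_self]
      simp only [h1, Finset.sum_const_zero]
      positivity
    · have hlog : 0 < Real.log (Fintype.card A) :=
        Real.log_pos (by exact_mod_cast Fintype.one_lt_card)
      have h := OMDP.mwu_regret_action hp h0 hs hk T a
      set G := ∑ t ∈ Finset.range T, (∑ b, p t b * k t b - k t a)
      set c := Real.sqrt (8 * Real.log (Fintype.card A) / T) with hc
      have hc0 : 0 < c := Real.sqrt_pos.2 (by positivity)
      -- The tuning makes both error terms equal to `T * c ^ 2 / 8`; dividing their sum by the rate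
      -- `c / R` gives `R * (T * c / 4)`.
      have hc2 : T * c ^ 2 = 8 * Real.log (Fintype.card A) := by
        rw [hc, Real.sq_sqrt (by positivity)]; field_simp
      have hsq : Real.sqrt (T * Real.log (Fintype.card A) / 2) = T * c / 4 := by
        rw [Real.sqrt_eq_iff_mul_self_eq (by positivity) (by positivity)]
        linear_combination -((T : ℝ) / 16) * hc2
      rw [OMDP.mwuRate, ← hc, div_pow, div_mul_cancel₀ _ (by positivity)] at h
      rw [hsq]
      have h3 : c * G ≤ R * (c * (T * c / 4)) := by
        have h4 : c * G = R * (c / R * G) := by field_simp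
        rw [h4]
        refine mul_le_mul_of_nonneg_left ?_ hR.le
        linarith
      exact le_of_mul_le_mul_left (by linarith) hc0
  rw [hmix]
  calc _ ≤ ∑ a, q a * (R * Real.sqrt (T * Real.log (Fintype.card A) / 2)) :=
        Finset.sum_le_sum fun a _ => mul_le_mul_of_nonneg_left (hact a) (hq.1 a)
    _ = _ := by rw [← Finset.sum_mul, hq.2, one_mul]

/-! ### The `ℓ¹` norm on state vectors. -/

open Matrix

theorem OMDP.abs_dotProduct_le_l1Norm {S : Type*} [Fintype S] (u m : S → ℝ)
    (hm : ∀ x, |m x| ≤ 1) : |u ⬝ᵥ m| ≤ OMDP.l1Norm u := by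
  refine (Finset.abs_sum_le_sum_abs _ _).trans (Finset.sum_le_sum fun x _ => ?_)
  rw [abs_mul]
  exact mul_le_of_le_one_right (abs_nonneg _) (hm x)

/-- Pairing a vector of total mass zero with a function of range `[0, 1]`. -/
theorem OMDP.dotProduct_le_half_l1Norm {S : Type*} [Fintype S] (u m : S → ℝ)
    (hu : ∑ x, u x = 0) (hm : ∀ x, m x ∈ Set.Icc (0 : ℝ) 1) :
    u ⬝ᵥ m ≤ OMDP.l1Norm u / 2 := by
  -- Mass zero allows recentring `m` into `[-1/2, 1/2]`, which gains the factor 2.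
  have h : u ⬝ᵥ m = ∑ x, u x * (m x - 1 / 2) := by
    simp_rw [mul_sub]
    rw [Finset.sum_sub_distrib, ← Finset.sum_mul, hu, zero_mul, sub_zero]
    rfl
  rw [h, OMDP.l1Norm, Finset.sum_div]
  refine Finset.sum_le_sum fun x _ => (le_abs_self _).trans ?_
  rw [abs_mul, div_eq_mul_one_div]
  refine mul_le_mul_of_nonneg_left (abs_le.2 ⟨?_, ?_⟩) (abs_nonneg _) <;>
    linarith [(hm x).1, (hm x).2]

theorem OMDP.l1Norm_add_le {S : Type*} [Fintype S] (u v : S → ℝ) :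
    OMDP.l1Norm (u + v) ≤ OMDP.l1Norm u + OMDP.l1Norm v := by
  rw [OMDP.l1Norm, OMDP.l1Norm, OMDP.l1Norm, ← Finset.sum_add_distrib]
  exact Finset.sum_le_sum fun x _ => abs_add_le _ _

theorem OMDP.l1Norm_sub_comm {S : Type*} [Fintype S] (u v : S → ℝ) :
    OMDP.l1Norm (u - v) = OMDP.l1Norm (v - u) := by
  simp only [OMDP.l1Norm, Pi.sub_apply, abs_sub_comm]

theorem OMDP.l1Norm_sub_le_two {S : Type*} [Fintype S] {d d' : S → ℝ}
    (hd : d ∈ stdSimplex ℝ S) (hd' : d' ∈ stdSimplex ℝ S) : OMDP.l1Norm (d - d') ≤ 2 := by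
  have h : ∀ {e : S → ℝ}, e ∈ stdSimplex ℝ S → OMDP.l1Norm e = 1 := fun {e} he => by
    rw [← he.2, OMDP.l1Norm]
    exact Finset.sum_congr rfl fun x _ => abs_of_nonneg (he.1 x)
  have h' : OMDP.l1Norm (-d') = OMDP.l1Norm d' := by simp [OMDP.l1Norm]
  rw [sub_eq_add_neg]
  refine (OMDP.l1Norm_add_le _ _).trans ?_
  rw [h', h hd, h hd']
  norm_num

/-! ### The state chain, its stationary law and the series for `Q`. -/

namespace OMDP.MDP

variable {S A : Type*} [Fintype S] [Fintype A] {M : OMDP.MDP S A}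

/-- The transition matrix of a policy is stochastic. -/
theorem vecMul_transMatrix_mem (M : OMDP.MDP S A) (π : OMDP.Policy S A) {d : S → ℝ}
    (hd : d ∈ stdSimplex ℝ S) : d ᵥ* M.transMatrix π ∈ stdSimplex ℝ S := by
  have h0 : ∀ x x', 0 ≤ M.transMatrix π x x' := fun x x' =>
    Finset.sum_nonneg fun a _ => mul_nonneg ((π.prob_mem x).1 a) ((M.trans_mem x a).1 x')
  have h1 : ∀ x, ∑ x', M.transMatrix π x x' = 1 := fun x => by
    simp only [transMatrix, Matrix.of_apply]
    rw [Finset.sum_comm]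
    simp_rw [← Finset.mul_sum, (M.trans_mem x _).2, mul_one]
    exact (π.prob_mem x).2
  refine ⟨fun x' => Finset.sum_nonneg fun x _ => mul_nonneg (hd.1 x) (h0 x x'), ?_⟩
  simp only [Matrix.vecMul, dotProduct]
  rw [Finset.sum_comm]
  simp_rw [← Finset.mul_sum, h1, mul_one]
  exact hd.2

theorem vecMul_transMatrix_pow_mem [DecidableEq S] (M : OMDP.MDP S A) (π : OMDP.Policy S A)
    {d : S → ℝ} (hd : d ∈ stdSimplex ℝ S) (n : ℕ) :
    d ᵥ* M.transMatrix π ^ n ∈ stdSimplex ℝ S := by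
  induction n with
  | zero => simpa using hd
  | succ n ih =>
    rw [pow_succ, ← Matrix.vecMul_vecMul]
    exact M.vecMul_transMatrix_mem π ih

theorem Mixing.l1Norm_pow_le [DecidableEq S] {τ : ℝ} (hmix : M.Mixing τ)
    (π : OMDP.Policy S A) {d d' : S → ℝ} (hd : d ∈ stdSimplex ℝ S) (hd' : d' ∈ stdSimplex ℝ S)
    (n : ℕ) : OMDP.l1Norm (d ᵥ* M.transMatrix π ^ n - d' ᵥ* M.transMatrix π ^ n)
      ≤ Real.exp (-1 / τ) ^ n * OMDP.l1Norm (d - d') := by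
  induction n with
  | zero => simp
  | succ n ih =>
    rw [pow_succ, ← Matrix.vecMul_vecMul, ← Matrix.vecMul_vecMul, pow_succ', mul_assoc]
    exact (hmix _ (M.vecMul_transMatrix_pow_mem π hd n) _
      (M.vecMul_transMatrix_pow_mem π hd' n) π).trans
        (mul_le_mul_of_nonneg_left ih (Real.exp_pos _).le)

/-- Under the mixing assumption the law of the state converges to a stationary distribution. -/
theorem Mixing.exists_stationary [DecidableEq S] {τ : ℝ} (hτ : 0 < τ) (hmix : M.Mixing τ)
    (π : OMDP.Policy S A) : ∃ ν ∈ stdSimplex ℝ S, ν ᵥ* M.transMatrix π = ν ∧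
      Tendsto (fun n => M.init ᵥ* M.transMatrix π ^ n) atTop (nhds ν) := by
  have hq : Real.exp (-1 / τ) < 1 := by
    rw [Real.exp_lt_one_iff]; exact div_neg_of_neg_of_pos (by norm_num) hτ
  -- Consecutive laws are the `n`-step images of two initial laws, so contraction makes their
  -- distances geometric.
  have hstep : ∀ n, M.init ᵥ* M.transMatrix π ^ (n + 1)
      = (M.init ᵥ* M.transMatrix π) ᵥ* M.transMatrix π ^ n := fun n => by
    rw [pow_succ', ← Matrix.vecMul_vecMul]
  have hc : CauchySeq fun n => M.init ᵥ* M.transMatrix π ^ n := by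
    refine cauchySeq_of_le_geometric _ 2 hq fun n => ?_
    rw [hstep, dist_pi_le_iff (by positivity)]
    intro x
    have h1 := hmix.l1Norm_pow_le π M.init_mem (M.vecMul_transMatrix_mem π M.init_mem) n
    have h2 := OMDP.l1Norm_sub_le_two M.init_mem (M.vecMul_transMatrix_mem π M.init_mem)
    rw [Real.dist_eq]
    calc _ ≤ _ := Finset.single_le_sum (f := fun x => |(M.init ᵥ* M.transMatrix π ^ n
              - (M.init ᵥ* M.transMatrix π) ᵥ* M.transMatrix π ^ n) x|)
              (fun _ _ => abs_nonneg _) (Finset.mem_univ x)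
      _ ≤ _ := h1
      _ ≤ _ := by rw [mul_comm]; exact mul_le_mul_of_nonneg_right h2 (by positivity)
  obtain ⟨ν, hν⟩ := cauchySeq_tendsto_of_complete hc
  refine ⟨ν, (isClosed_stdSimplex ℝ S).mem_of_tendsto hν
    (Eventually.of_forall fun n => M.vecMul_transMatrix_pow_mem π M.init_mem n), ?_, hν⟩
  have hcont : Continuous fun d : S → ℝ => d ᵥ* M.transMatrix π := by fun_prop
  refine tendsto_nhds_unique ((hcont.tendsto ν).comp hν) ?_
  refine ((tendsto_add_atTop_iff_nat 1).2 hν).congr fun n => ?_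
  rw [pow_succ, ← Matrix.vecMul_vecMul]
  rfl

/-- Peels off the first transition, while `law` recurses on the last. In `Q` the first action is
prescribed, and only after one transition does the law have the product form handled by
`law_of_policy`. -/
theorem law_succ (M : OMDP.MDP S A) (π : OMDP.Policy S A) (v : S → A → ℝ) (n : ℕ) :
    M.law π v (n + 1) = M.law π (M.law π v 1) n := by
  induction n with
  | zero => rfl
  | succ n ih => rw [law, ih]; rfl

theorem law_of_policy [DecidableEq S] (M : OMDP.MDP S A) (π : OMDP.Policy S A) (d : S → ℝ)
    (n : ℕ) : M.law π (fun x a => d x * π.prob x a) n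
      = fun x a => (d ᵥ* M.transMatrix π ^ n) x * π.prob x a := by
  induction n with
  | zero => simp [law]
  | succ n ih =>
    rw [law, ih, pow_succ, ← Matrix.vecMul_vecMul]
    funext x' a'
    congr 1
    simp only [Matrix.vecMul, dotProduct, transMatrix, Matrix.of_apply]
    simp_rw [Finset.mul_sum, mul_assoc]

theorem pairing_of_policy (l : S → A → ℝ) (π : OMDP.Policy S A) (d : S → ℝ) :
    OMDP.pairing l (fun x a => d x * π.prob x a)
      = d ⬝ᵥ fun x => ∑ a, π.prob x a * l x a := by
  simp only [OMDP.pairing, dotProduct, Finset.mul_sum]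
  exact Finset.sum_congr rfl fun x _ => Finset.sum_congr rfl fun a _ => by ring

/-- `stationary` is a `limUnder`, meaningful only once convergence is known; this replaces it by a
genuine invariant state law. -/
theorem Mixing.exists_stationary_eq [DecidableEq S] {τ : ℝ} (hτ : 0 < τ) (hmix : M.Mixing τ)
    (π : OMDP.Policy S A) : ∃ ν ∈ stdSimplex ℝ S, ν ᵥ* M.transMatrix π = ν ∧
      M.stationary π = fun x a => ν x * π.prob x a := by
  obtain ⟨ν, hν, hinv, hlim⟩ := hmix.exists_stationary hτ π
  refine ⟨ν, hν, hinv, ?_⟩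
  funext x a
  refine Tendsto.limUnder_eq ?_
  simp only [occupancy, M.law_of_policy]
  exact ((tendsto_pi_nhds.1 hlim) x).mul_const _

/-- The one-step law from a state-action pair. -/
theorem law_one_single (M : OMDP.MDP S A) (π : OMDP.Policy S A) (s : S) (a : A)
    [∀ x b, Decidable (x = s ∧ b = a)] :
    M.law π (fun x b => if x = s ∧ b = a then 1 else 0) 1
      = fun x b => M.trans s a x * π.prob x b := by
  funext x b
  simp only [law]
  congr 1
  rw [Finset.sum_eq_single s (fun y _ hy => by simp [hy]) (by simp),
    Finset.sum_eq_single a (fun y _ hy => by simp [hy]) (by simp)]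
  simp

theorem pairing_single (l : S → A → ℝ) (s : S) (a : A) [∀ x b, Decidable (x = s ∧ b = a)] :
    OMDP.pairing l (fun x b => if x = s ∧ b = a then 1 else 0) = l s a := by
  rw [OMDP.pairing, Finset.sum_eq_single s (fun y _ hy => by simp [hy]) (by simp),
    Finset.sum_eq_single a (fun y _ hy => by simp [hy]) (by simp)]
  simp

/-- The expected excess losses along a policy, starting from the state law `d`, are summable. -/
theorem Mixing.summable_excess [DecidableEq S] {τ : ℝ} (hτ : 0 < τ) (hmix : M.Mixing τ)
    (π : OMDP.Policy S A) {d ν m : S → ℝ} (hd : d ∈ stdSimplex ℝ S) (hν : ν ∈ stdSimplex ℝ S)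
    (hinv : ν ᵥ* M.transMatrix π = ν) (hm : ∀ x, m x ∈ Set.Icc (0 : ℝ) 1) :
    Summable fun n : ℕ => (d ᵥ* M.transMatrix π ^ n) ⬝ᵥ m - ν ⬝ᵥ m := by
  have hq : Real.exp (-1 / τ) < 1 := by
    rw [Real.exp_lt_one_iff]; exact div_neg_of_neg_of_pos (by norm_num) hτ
  have hinv' : ∀ n : ℕ, ν ᵥ* M.transMatrix π ^ n = ν := fun n => by
    induction n with
    | zero => simp
    | succ n ih => rw [pow_succ, ← Matrix.vecMul_vecMul, ih, hinv]
  refine Summable.of_norm_bounded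
    ((summable_geometric_of_lt_one (Real.exp_pos _).le hq).mul_right 2) fun n => ?_
  rw [Real.norm_eq_abs, ← sub_dotProduct]
  refine (OMDP.abs_dotProduct_le_l1Norm _ _ fun x => abs_le.2
    ⟨by linarith [(hm x).1], (hm x).2⟩).trans ?_
  conv_lhs => rw [← hinv' n]
  exact (hmix.l1Norm_pow_le π hd hν n).trans
    (mul_le_mul_of_nonneg_left (OMDP.l1Norm_sub_le_two hd hν) (by positivity))

/-- Unfolding the first step of the accumulated loss. -/
theorem Mixing.Q_eq [DecidableEq S] {τ : ℝ} (hτ : 0 < τ) (hmix : M.Mixing τ)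
    (π : OMDP.Policy S A) {ν : S → ℝ} (hν : ν ∈ stdSimplex ℝ S)
    (hinv : ν ᵥ* M.transMatrix π = ν) (hst : M.stationary π = fun x a => ν x * π.prob x a)
    {l : S → A → ℝ} (hm : ∀ x, (∑ a, π.prob x a * l x a) ∈ Set.Icc (0 : ℝ) 1) (s : S) (a : A) :
    M.Q π l s a = l s a - M.avgLoss π l + ∑' n : ℕ, ((M.trans s a ᵥ* M.transMatrix π ^ n) ⬝ᵥ
        (fun x => ∑ a, π.prob x a * l x a) - ν ⬝ᵥ fun x => ∑ a, π.prob x a * l x a) := by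
  have hη : M.avgLoss π l = ν ⬝ᵥ fun x => ∑ a, π.prob x a * l x a := by
    rw [avgLoss, hst, pairing_of_policy]
  have hs (_ : ∀ x b, Decidable (x = s ∧ b = a)) (n : ℕ) : OMDP.pairing l (M.law π
      (fun x b => if x = s ∧ b = a then 1 else 0) (n + 1)) - M.avgLoss π l
      = (M.trans s a ᵥ* M.transMatrix π ^ n) ⬝ᵥ
        (fun x => ∑ a, π.prob x a * l x a) - ν ⬝ᵥ fun x => ∑ a, π.prob x a * l x a := by
    rw [law_succ, law_one_single, law_of_policy, pairing_of_policy, hη]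
  rw [Q, Summable.tsum_eq_zero_add]
  · congr 1
    · rw [law, pairing_single]
    · exact tsum_congr fun n => hs _ n
  · rw [← summable_nat_add_iff 1]
    exact (hmix.summable_excess hτ π (M.trans_mem s a) hν hinv hm).congr fun n => (hs _ n).symm

end OMDP.MDP

/-! ### The performance difference identity. -/

namespace OMDP.MDP

variable {S A : Type*} [Fintype S] [Fintype A] {M : OMDP.MDP S A}

/-- The total excess loss from the law `d` is the `d`-average of those from single states. -/
theorem Mixing.tsum_excess_eq [DecidableEq S] {τ : ℝ} (hτ : 0 < τ) (hmix : M.Mixing τ)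
    (π : OMDP.Policy S A) {d ν m : S → ℝ} (hd : d ∈ stdSimplex ℝ S) (hν : ν ∈ stdSimplex ℝ S)
    (hinv : ν ᵥ* M.transMatrix π = ν) (hm : ∀ x, m x ∈ Set.Icc (0 : ℝ) 1) :
    ∑' n : ℕ, ((d ᵥ* M.transMatrix π ^ n) ⬝ᵥ m - ν ⬝ᵥ m)
      = d ⬝ᵥ fun x => ∑' n : ℕ, ((Pi.single x 1 ᵥ* M.transMatrix π ^ n) ⬝ᵥ m - ν ⬝ᵥ m) := by
  have h := fun x : S => (hmix.summable_excess hτ π (single_mem_stdSimplex ℝ x) hν hinv hm).hasSum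
  have h' := hasSum_sum fun (x : S) (_ : x ∈ Finset.univ) => (h x).mul_left (d x)
  refine Eq.trans (tsum_congr fun n => ?_) h'.tsum_eq
  simp_rw [mul_sub]
  rw [Finset.sum_sub_distrib, ← Finset.sum_mul, hd.2, one_mul]
  simp_rw [← Matrix.dotProduct_mulVec, single_one_dotProduct]
  rfl

/-- The performance difference identity. -/
theorem Mixing.avgLoss_sub_avgLoss {τ : ℝ} (hτ : 0 < τ) (hmix : M.Mixing τ)
    (π : OMDP.Policy S A) {l : S → A → ℝ}
    (hm : ∀ x, (∑ a, π.prob x a * l x a) ∈ Set.Icc (0 : ℝ) 1) (π' : OMDP.Policy S A)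
    {ν' : S → ℝ} (hν' : ν' ∈ stdSimplex ℝ S) (hinv' : ν' ᵥ* M.transMatrix π' = ν')
    (hst' : M.stationary π' = fun x a => ν' x * π'.prob x a) :
    M.avgLoss π l - M.avgLoss π' l
      = ∑ s, ν' s * (∑ a, π.prob s a * M.Q π l s a - ∑ a, π'.prob s a * M.Q π l s a) := by
  classical
  obtain ⟨ν, hν, hinv, hst⟩ := hmix.exists_stationary_eq hτ π
  set m : S → ℝ := fun x => ∑ a, π.prob x a * l x a
  set W : S → ℝ := fun x =>
    ∑' n : ℕ, ((Pi.single x 1 ᵥ* M.transMatrix π ^ n) ⬝ᵥ m - ν ⬝ᵥ m) with hW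
  have hη : M.avgLoss π l = ν ⬝ᵥ m := by rw [avgLoss, hst, pairing_of_policy]
  -- Bellman equation: `W` is the total excess loss from a state under `π`.
  have hQ : ∀ s a, M.Q π l s a = l s a - M.avgLoss π l + M.trans s a ⬝ᵥ W := fun s a => by
    rw [hmix.Q_eq hτ π hν hinv hst hm, hmix.tsum_excess_eq hτ π (M.trans_mem s a) hν hinv hm]
  have havg : ∀ (ρ : OMDP.Policy S A) s, ∑ a, ρ.prob s a * M.Q π l s a
      = ∑ a, ρ.prob s a * l s a - M.avgLoss π l + (M.transMatrix ρ *ᵥ W) s := fun ρ s => by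
    simp_rw [hQ, mul_add, mul_sub]
    rw [Finset.sum_add_distrib, Finset.sum_sub_distrib, ← Finset.sum_mul, (ρ.prob_mem s).2,
      one_mul]
    congr 1
    simp only [Matrix.mulVec, dotProduct, transMatrix, Matrix.of_apply]
    simp_rw [Finset.sum_mul, Finset.mul_sum]
    rw [Finset.sum_comm]
    simp_rw [mul_assoc]
  -- Splitting off the first term of the series for `W` shows that `W` solves the Poisson equation
  -- of `π`.
  have hV : ∀ s, ∑ a, π.prob s a * M.Q π l s a = W s := fun s => by
    rw [havg, hη]
    have hs := single_mem_stdSimplex ℝ s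
    have h1 := hmix.tsum_excess_eq hτ π (M.vecMul_transMatrix_mem π hs) hν hinv hm
    conv_rhs => rw [hW]
    simp only
    rw [(hmix.summable_excess hτ π hs hν hinv hm).tsum_eq_zero_add]
    simp_rw [pow_succ', ← Matrix.vecMul_vecMul]
    rw [h1, pow_zero, Matrix.vecMul_one, single_one_dotProduct, ← Matrix.dotProduct_mulVec,
      single_one_dotProduct]
  -- Invariance of `ν'` under `π'` cancels `W`, leaving only the average losses.
  have h2 : ν' ⬝ᵥ (M.transMatrix π' *ᵥ W) = ν' ⬝ᵥ W := by
    rw [Matrix.dotProduct_mulVec, hinv']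
  have h3 : M.avgLoss π' l = ν' ⬝ᵥ fun x => ∑ a, π'.prob x a * l x a := by
    rw [avgLoss, hst', pairing_of_policy]
  simp_rw [hV, havg, mul_sub, mul_add, mul_sub]
  rw [Finset.sum_sub_distrib, Finset.sum_add_distrib, Finset.sum_sub_distrib, ← Finset.sum_mul,
    hν'.2, one_mul]
  simp only [dotProduct] at h2 h3
  rw [h2, h3]
  ring

/-! ### The range of `Q` over the actions of a state. -/

/-- Under the mixing assumption for all policies, two actions in the same state lead to close
laws of the next state. -/
theorem Mixing.l1Norm_trans_sub_le {τ : ℝ} (hmix : M.Mixing τ) (s : S) (a b : A) :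
    OMDP.l1Norm (M.trans s a - M.trans s b) ≤ 4 * Real.exp (-1 / τ) := by
  classical
  -- Mixing compares two states under one policy, not two actions in one state. A policy playing `c`
  -- in `s` and `b` in `s'` compares `P(· | s, c)` with `P(· | s', b)`; taking `c = a` and `c = b`,
  -- the triangle inequality gives `2q + 2q`. Without a second state, both laws are the point mass.
  by_cases hs : ∃ s', s' ≠ s
  · obtain ⟨s', hs'⟩ := hs
    have key : ∀ c, OMDP.l1Norm (M.trans s c - M.trans s' b) ≤ 2 * Real.exp (-1 / τ) := by
      intro c
      let ρ : OMDP.Policy S A := ⟨fun x => Pi.single (if x = s then c else b) 1,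
        fun x => single_mem_stdSimplex ℝ _⟩
      have hρ : ∀ x, Pi.single x 1 ᵥ* M.transMatrix ρ
          = M.trans x (if x = s then c else b) := fun x => by
        funext x'
        rw [Matrix.single_one_vecMul]
        simp [transMatrix, ρ, Pi.single_apply]
      have h := hmix _ (single_mem_stdSimplex ℝ s) _ (single_mem_stdSimplex ℝ s') ρ
      rw [hρ, hρ, if_pos rfl, if_neg hs'] at h
      refine h.trans ?_
      rw [mul_comm]
      exact mul_le_mul_of_nonneg_right (OMDP.l1Norm_sub_le_two (single_mem_stdSimplex ℝ s)
        (single_mem_stdSimplex ℝ s')) (Real.exp_pos _).le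
    have h1 := key a
    have h2 := key b
    rw [OMDP.l1Norm_sub_comm] at h2
    have h3 := OMDP.l1Norm_add_le (M.trans s a - M.trans s' b) (M.trans s' b - M.trans s b)
    rw [sub_add_sub_cancel] at h3
    linarith
  · push Not at hs
    have h : ∀ c, M.trans s c = 1 := fun c => by
      funext x
      have h1 := (M.trans_mem s c).2
      rw [Finset.sum_eq_single x (fun y _ hy => absurd ((hs y).trans (hs x).symm) hy)
        (by simp)] at h1
      exact h1
    rw [h, h]
    simp only [sub_self, OMDP.l1Norm, Pi.zero_apply, abs_zero, Finset.sum_const_zero]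
    positivity

/-- In each state, the accumulated losses of two actions differ by at most `3 * τ`. -/
theorem Mixing.Q_sub_Q_le {τ : ℝ} (hτ : 1 / 2 ≤ τ) (hmix : M.Mixing τ) (π : OMDP.Policy S A)
    {l : S → A → ℝ} (hl : ∀ x a, l x a ∈ Set.Icc (0 : ℝ) 1)
    (hm : ∀ x, (∑ a, π.prob x a * l x a) ∈ Set.Icc (0 : ℝ) 1) (s : S) (a b : A) :
    M.Q π l s a - M.Q π l s b ≤ 3 * τ := by
  classical
  have hτ0 : 0 < τ := by linarith
  obtain ⟨ν, hν, hinv, hst⟩ := hmix.exists_stationary_eq hτ0 π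
  set q := Real.exp (-1 / τ) with hqdef
  have hq0 : 0 < q := Real.exp_pos _
  have hq : q < 1 := by
    rw [hqdef, Real.exp_lt_one_iff]; exact div_neg_of_neg_of_pos (by norm_num) hτ0
  have hsa := hmix.summable_excess hτ0 π (M.trans_mem s a) hν hinv hm
  have hsb := hmix.summable_excess hτ0 π (M.trans_mem s b) hν hinv hm
  rw [hmix.Q_eq hτ0 π hν hinv hst hm, hmix.Q_eq hτ0 π hν hinv hst hm, add_sub_add_comm,
    sub_sub_sub_cancel_right, ← hsa.tsum_sub hsb]
  have hle : ∑' n : ℕ, (((M.trans s a ᵥ* M.transMatrix π ^ n) ⬝ᵥ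
        (fun x => ∑ a, π.prob x a * l x a) - ν ⬝ᵥ fun x => ∑ a, π.prob x a * l x a)
      - ((M.trans s b ᵥ* M.transMatrix π ^ n) ⬝ᵥ
        (fun x => ∑ a, π.prob x a * l x a) - ν ⬝ᵥ fun x => ∑ a, π.prob x a * l x a))
      ≤ ∑' n : ℕ, q ^ n * (2 * q) := by
    refine (hsa.sub hsb).tsum_le_tsum (fun n => ?_)
      ((summable_geometric_of_lt_one hq0.le hq).mul_right _)
    rw [sub_sub_sub_cancel_right, ← sub_dotProduct]
    refine (OMDP.dotProduct_le_half_l1Norm _ _ ?_ hm).trans ?_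
    · simp only [Pi.sub_apply]
      rw [Finset.sum_sub_distrib, (M.vecMul_transMatrix_pow_mem π (M.trans_mem s a) n).2,
        (M.vecMul_transMatrix_pow_mem π (M.trans_mem s b) n).2, sub_self]
    · have h1 := hmix.l1Norm_pow_le π (M.trans_mem s a) (M.trans_mem s b) n
      have h2 := mul_le_mul_of_nonneg_left (hmix.l1Norm_trans_sub_le s a b)
        (pow_nonneg hq0.le n)
      rw [← hqdef] at h1 h2
      linarith
  rw [tsum_mul_right, tsum_geometric_of_lt_one hq0.le hq] at hle
  -- The left side is `(1 + q) / (1 - q)`. With `x = 1 / τ` the claim becomes `3 + x ≤ (3 - x) * exp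
  -- x`. Using `exp x ≥ 1 + x + x ^ 2 / 2`, the slack is at least `x * (2 - x) * (1 + x) / 2`,
  -- nonnegative because `τ ≥ 1 / 2` gives `x ≤ 2`.
  have hnum : 1 + (1 - q)⁻¹ * (2 * q) ≤ 3 * τ := by
    have hexp : q * Real.exp (1 / τ) = 1 := by
      rw [hqdef, ← Real.exp_add, neg_div, neg_add_cancel, Real.exp_zero]
    set x := 1 / τ with hx
    have hx0 : 0 < x := by positivity
    have hx2 : x ≤ 2 := by rw [hx, div_le_iff₀ hτ0]; linarith
    have hxτ : x * τ = 1 := by rw [hx]; field_simp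
    have he := Real.quadratic_le_exp_of_nonneg hx0.le
    have h1 : 3 + x ≤ (3 - x) * Real.exp x := by
      have h2 := mul_le_mul_of_nonneg_left he (by linarith : 0 ≤ 3 - x)
      nlinarith [mul_nonneg hx0.le (mul_nonneg (by linarith : 0 ≤ 2 - x) (by linarith : 0 ≤ 1 + x))]
    have h3 : q * (3 + x) ≤ 3 - x := by
      have := mul_le_mul_of_nonneg_left h1 hq0.le
      calc q * (3 + x) ≤ q * ((3 - x) * Real.exp x) := this
        _ = (3 - x) * (q * Real.exp x) := by ring
        _ = _ := by rw [hexp, mul_one]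
    have h4 : x * (1 + q) ≤ 3 * (1 - q) := by linarith
    have h5 : 1 + q ≤ 3 * τ * (1 - q) := by
      have := mul_le_mul_of_nonneg_left h4 hτ0.le
      calc 1 + q = τ * (x * (1 + q)) := by rw [← mul_assoc, mul_comm τ, hxτ, one_mul]
        _ ≤ _ := this
        _ = _ := by ring
    have h6 : 1 + (1 - q)⁻¹ * (2 * q) = (1 + q) / (1 - q) := by
      have : (1 - q) ≠ 0 := by linarith
      field_simp
      ring
    rw [h6, div_le_iff₀ (by linarith)]
    exact h5
  linarith [(hl s a).2, (hl s b).1]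

end OMDP.MDP

/-! ### Regret of the agent and of the adversary. -/

/-- Every mixture of losses with values in `[0, 1]` has values in `[0, 1]`. -/
theorem OMDP.sum_mul_mem_Icc {ι : Type*} [Fintype ι] {w f : ι → ℝ} (hw : w ∈ stdSimplex ℝ ι)
    (hf : ∀ i, f i ∈ Set.Icc (0 : ℝ) 1) : ∑ i, w i * f i ∈ Set.Icc (0 : ℝ) 1 := by
  refine ⟨Finset.sum_nonneg fun i _ => mul_nonneg (hw.1 i) (hf i).1, ?_⟩
  rw [← hw.2]
  exact Finset.sum_le_sum fun i _ => mul_le_of_le_one_right (hw.1 i) (hf i).2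

/-- Regret of MDP-Expert against a fixed policy, measured with stationary distributions. -/
theorem OMDP.FollowsMDPE.regret {S A : Type*} [Fintype S] [Fintype A] {M : OMDP.MDP S A}
    {τ : ℝ} (hτ : 1 / 2 ≤ τ) (hmix : M.Mixing τ) {L : ℕ} {ℓ : Fin L → S → A → ℝ}
    (hℓ : ∀ i x a, ℓ i x a ∈ Set.Icc (0 : ℝ) 1) {T : ℕ} {adv : OMDP.Adversary ℓ}
    {πs : ℕ → OMDP.Policy S A}
    (hπs : OMDP.FollowsMDPE M adv (OMDP.mwuRate (Fintype.card A) T (3 * τ)) πs)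
    (π : OMDP.Policy S A) :
    ∑ t ∈ Finset.range T, (M.avgLoss (πs t) (adv.loss πs t) - M.avgLoss π (adv.loss πs t))
      ≤ 3 * τ * Real.sqrt (T * Real.log (Fintype.card A) / 2) := by
  classical
  have hτ0 : 0 < τ := by linarith
  have hl : ∀ t x a, adv.loss πs t x a ∈ Set.Icc (0 : ℝ) 1 := fun t x a => by
    obtain ⟨w, hw, h⟩ := adv.respond_mem t fun i => πs i
    rw [OMDP.Adversary.loss, h]
    exact OMDP.sum_mul_mem_Icc hw fun i => hℓ i x a
  have hm : ∀ t x, (∑ a, (πs t).prob x a * adv.loss πs t x a) ∈ Set.Icc (0 : ℝ) 1 :=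
    fun t x => OMDP.sum_mul_mem_Icc ((πs t).prob_mem x) (hl t x)
  obtain ⟨ν, hν, hinv, hst⟩ := hmix.exists_stationary_eq hτ0 π
  simp_rw [fun t => hmix.avgLoss_sub_avgLoss hτ0 (πs t) (hm t) π hν hinv hst]
  -- The weights `ν s` come from the comparator and do not depend on the round, so the sum over
  -- rounds can be taken inside, state by state.
  rw [Finset.sum_comm]
  simp_rw [← Finset.mul_sum]
  calc _ ≤ ∑ s, ν s * (3 * τ * Real.sqrt (T * Real.log (Fintype.card A) / 2)) :=
        Finset.sum_le_sum fun s _ => mul_le_mul_of_nonneg_left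
          (OMDP.mwu_regret (by linarith) (fun t => (πs t).prob_mem s) (hπs.1 s)
            (fun t => hπs.2 t s)
            (fun t a b => hmix.Q_sub_Q_le hτ (πs t) (hl t) (hm t) s a b) (π.prob_mem s))
          (hν.1 s)
    _ = _ := by rw [← Finset.sum_mul, hν.2, one_mul]

theorem OMDP.convex_lossSimplex {S A : Type*} {L : ℕ} (ℓ : Fin L → S → A → ℝ) :
    Convex ℝ (OMDP.lossSimplex ℓ) := by
  rintro _ ⟨w, hw, rfl⟩ _ ⟨w', hw', rfl⟩ α β hα hβ hαβ
  refine ⟨α • w + β • w', convex_stdSimplex ℝ _ hw hw' hα hβ hαβ, ?_⟩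
  funext x a
  simp only [Pi.add_apply, Pi.smul_apply, smul_eq_mul, add_mul, Finset.sum_add_distrib,
    Finset.mul_sum, mul_assoc]

/-- Against a fixed policy, the adversary does at least as well as with the average of any losses
from its strategy set, up to its external regret. -/
theorem OMDP.Adversary.NoExternalRegret.sum_pairing_sub_le {S A : Type*} [Fintype S] [Fintype A]
    {M : OMDP.MDP S A} {L : ℕ} {ℓ : Fin L → S → A → ℝ} {T : ℕ} {adv : OMDP.Adversary ℓ}
    (hadv : adv.NoExternalRegret M T) {l : ℕ → S → A → ℝ} (hl : ∀ t, l t ∈ OMDP.lossSimplex ℓ)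
    (π : OMDP.Policy S A) :
    ∑ t ∈ Finset.range T, OMDP.pairing (l t) (M.stationary π)
        - ∑ t ∈ Finset.range T, OMDP.pairing (adv.loss (fun _ => π) t) (M.stationary π)
      ≤ Real.sqrt (T * Real.log L / 2) := by
  rcases Nat.eq_zero_or_pos T with rfl | hT
  · simp
  have hT' : (0 : ℝ) < T := by exact_mod_cast hT
  -- Since `d_π` is the same in every round, playing the average loss `T` times costs exactly as
  -- much as playing the `l t` in turn.
  have hmem : ∑ t ∈ Finset.range T, (1 / T : ℝ) • l t ∈ OMDP.lossSimplex ℓ :=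
    (OMDP.convex_lossSimplex ℓ).sum_mem (fun _ _ => by positivity)
      (by simp [hT'.ne']) fun t _ => hl t
  have h := hadv (fun _ => π) _ hmem
  have havg : OMDP.pairing (∑ t ∈ Finset.range T, (1 / T : ℝ) • l t) (M.stationary π)
      = 1 / T * ∑ t ∈ Finset.range T, OMDP.pairing (l t) (M.stationary π) := by
    simp only [OMDP.pairing, Finset.sum_apply, Pi.smul_apply, smul_eq_mul, Finset.sum_mul,
      Finset.mul_sum]
    rw [Finset.sum_comm]
    simp_rw [Finset.sum_comm (s := Finset.range T), mul_assoc]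
    rw [Finset.sum_comm]
  rw [Finset.sum_const, Finset.card_range, nsmul_eq_mul, havg, ← mul_assoc,
    mul_one_div_cancel hT'.ne', one_mul] at h
  exact h

/-- The policies `πs` are those of MDP-Expert; the comparator `π` is any stationary policy, and
the adversary's losses against it are those it plays when the agent uses `π` in all rounds. -/
theorem mainTheorem2 {S A : Type*} [Fintype S] [Fintype A] (M : OMDP.MDP S A)
    (τ : ℝ) (hτ : 1 / 2 ≤ τ) (hmix : M.Mixing τ)
    {L : ℕ} (ℓ : Fin L → S → A → ℝ) (hℓ : ∀ i x a, ℓ i x a ∈ Set.Icc (0 : ℝ) 1)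
    (T : ℕ) (adv : OMDP.Adversary ℓ) (hadv : adv.NoExternalRegret M T)
    (πs : ℕ → OMDP.Policy S A)
    (hπs : OMDP.FollowsMDPE M adv (OMDP.mwuRate (Fintype.card A) T (3 * τ)) πs)
    (π : OMDP.Policy S A) :
    ∑ t ∈ Finset.range T, OMDP.pairing (adv.loss πs t) (M.stationary (πs t))
        - ∑ t ∈ Finset.range T, OMDP.pairing (adv.loss (fun _ => π) t) (M.stationary π)
      ≤ Real.sqrt (T * Real.log L / 2)
        + 3 * τ * Real.sqrt (T * Real.log (Fintype.card A) / 2) := by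
  have h1 := OMDP.FollowsMDPE.regret hτ hmix hℓ hπs π
  have h2 := hadv.sum_pairing_sub_le (l := adv.loss πs) (fun t => adv.respond_mem t _) π
  rw [Finset.sum_sub_distrib] at h1
  simp only [OMDP.MDP.avgLoss] at h1
  linarith
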